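/- Let $n,k,\ell$ be positive integers with $\ell\le k$. An $\ell$-rook in the hypercube $\{0,\dots,n-1\}^k$ is a point of the hypercube together with a choice of $\ell$ of the $k$ coordinates; it covers its own point and every point that differs from it in exactly one coordinate, that coordinate being one of the chosen ones. Let $a_{n,k,\ell}$ be the minimum number of $\ell$-rooks, no two at the same point, that together cover all of $\{0,\dots,n-1\}^k$, and let \[a_{k,\ell}=\lim_{n\to\infty}\frac{a_{n,k,\ell}}{n^{k-1}} .\] For $k\ge 2$ let $f(k)$ be the largest integer $m\le k$ of the form $m=p^e+1$ with $p$ prime and $e\ge 0$. Theorem. Let $k\ge 2$ and $\ell\ge 1$ be integers with $f(k)\ge \ell$. Then the limit $a_{k,\ell}$ exists and \[a_{k,\ell}\le \frac{1}{f(k)-1}\left\lceil\frac{f(k)}{\ell}\right\rceil .\] More generally, \[a_{k,\ell}\le \frac{1}{m-1}\left\lceil\frac{m}{\ell}\right\rceil\] for every integer $m$ with $\ell\le m\le k$ that is of the form $m=p^e+1$ with $p$ prime and $e\ge 0$. -/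

import Mathlib

open Filter Topology

/-- An `ℓ`-rook in the hypercube `{0, …, n-1}^k`: a point together with a choice of `ℓ` of the
`k` coordinate directions. -/
structure Rook (n k ℓ : ℕ) where
  pos : Fin k → Fin n
  dirs : Finset (Fin k)
  card_dirs : dirs.card = ℓ

/-- A rook covers the points on the axis-parallel lines through its position in the chosen
directions (its own position included). -/
def Rook.Covers {n k ℓ : ℕ} (r : Rook n k ℓ) (x : Fin k → Fin n) : Prop :=
  ∃ i ∈ r.dirs, ∀ j, j ≠ i → x j = r.pos j

/-- A covering of the hypercube by `ℓ`-rooks, with at most one rook at each point. -/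
def IsRookCovering {n k ℓ : ℕ} (S : Finset (Rook n k ℓ)) : Prop :=
  Set.InjOn Rook.pos (S : Set (Rook n k ℓ)) ∧ ∀ x : Fin k → Fin n, ∃ r ∈ S, r.Covers x

/-- The minimum number `a_{n,k,ℓ}` of `ℓ`-rooks in a covering of `{0, …, n-1}^k`. -/
noncomputable def rookCoverNumber (n k ℓ : ℕ) : ℕ :=
  sInf {N : ℕ | ∃ S : Finset (Rook n k ℓ), IsRookCovering S ∧ S.card = N}

/-- The normalized number `a_{n,k,ℓ} / n^{k-1}`. -/
noncomputable def rookCoverRatio (k ℓ n : ℕ) : ℝ :=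
  (rookCoverNumber n k ℓ : ℝ) / (n : ℝ) ^ (k - 1)

/-- The limit `a_{k,ℓ}` of `a_{n,k,ℓ} / n^{k-1}` as `n → ∞` (meaningful when it exists). -/
noncomputable def rookCoverLimit (k ℓ : ℕ) : ℝ :=
  limUnder atTop (rookCoverRatio k ℓ)

/-- `m` is one more than a power `p ^ e` (`e ≥ 0`) of a prime `p`. -/
def IsPrimePowerSucc (m : ℕ) : Prop :=
  ∃ p e : ℕ, p.Prime ∧ m = p ^ e + 1

open scoped Classical in
/-- The largest integer `m ≤ k` that is one more than a power of a prime. -/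
noncomputable def largestPrimePowerSucc (k : ℕ) : ℕ :=
  Nat.findGreatest IsPrimePowerSucc k

/-! Let `q = p ^ e` and `q + 1 ≤ k`. A linear code of size `q ^ (k - 2)` over a field with `q`
elements has covering radius one using only the first `q + 1` coordinates (`exists_covering_code`).
Split these directions into `g = ⌈(q + 1) / ℓ⌉` groups of at most `ℓ`. Over the alphabet `ZMod g ×
F`, put rooks above all codewords and let the sum of the `ZMod g` components select the group
(`rookCoverNumber_blowup_le`): moving along one line reaches any prescribed sum, so every group is
available to every point. This takes `g * g ^ (k - 1) * q ^ (k - 2)` rooks in side `g * q`, a ratio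
of `g / q`.

One side length is enough, because the limit is the infimum of the ratios
(`tendsto_rookCoverRatio_and_le`). -/

/-- The points of `P`, each equipped with the directions that `D` gives it, cover `α ^ k`. -/
def LineCovers {k : ℕ} {α : Type*} (P : Finset (Fin k → α))
    (D : (Fin k → α) → Finset (Fin k)) : Prop :=
  ∀ x : Fin k → α, ∃ p ∈ P, ∃ i ∈ D p, ∀ j, j ≠ i → x j = p j

/-! ### Rook coverings as point sets with directions, over any alphabet -/

theorem rookCoverNumber_le_card_of_fin {n k ℓ : ℕ} (P : Finset (Fin k → Fin n))
    (D : (Fin k → Fin n) → Finset (Fin k)) (hD : ∀ x, (D x).card = ℓ) (h : LineCovers P D) :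
    rookCoverNumber n k ℓ ≤ P.card := by
  classical
  let e : (Fin k → Fin n) ↪ Rook n k ℓ :=
    ⟨fun x => ⟨x, D x, hD x⟩, fun x y hxy => congrArg Rook.pos hxy⟩
  refine Nat.sInf_le ⟨P.map e, ⟨?_, ?_⟩, Finset.card_map e⟩
  · intro a ha b hb hab
    simp only [Finset.coe_map, Set.mem_image] at ha hb
    obtain ⟨x, -, rfl⟩ := ha
    obtain ⟨y, -, rfl⟩ := hb
    have hxy : x = y := hab
    rw [hxy]
  · intro x
    obtain ⟨p, hp, i, hi, hx⟩ := h x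
    exact ⟨e p, Finset.mem_map_of_mem e hp, i, hi, hx⟩

theorem rookCoverNumber_le_card {n k ℓ : ℕ} {α : Type*} [Fintype α] (hα : Fintype.card α = n)
    (P : Finset (Fin k → α)) (D : (Fin k → α) → Finset (Fin k)) (hD : ∀ x, (D x).card = ℓ)
    (h : LineCovers P D) : rookCoverNumber n k ℓ ≤ P.card := by
  classical
  let e : α ≃ Fin n := Fintype.equivFinOfCardEq hα
  let E : (Fin k → α) ≃ (Fin k → Fin n) := Equiv.arrowCongr (Equiv.refl _) e
  rw [← Finset.card_map E.toEmbedding]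
  refine rookCoverNumber_le_card_of_fin _ (fun x => D (E.symm x)) (fun x => hD _) ?_
  intro x
  obtain ⟨p, hp, i, hi, hx⟩ := h (E.symm x)
  refine ⟨E p, Finset.mem_map_of_mem _ hp, i, by simpa using hi, fun j hj => ?_⟩
  have := congrArg e (hx j hj)
  simpa [E] using this

theorem exists_finset_fin_card {k ℓ : ℕ} (hℓk : ℓ ≤ k) (A : Finset (Fin k)) (hA : A.card ≤ ℓ) :
    ∃ B : Finset (Fin k), A ⊆ B ∧ B.card = ℓ := by
  obtain ⟨B, hAB, -, hB⟩ := Finset.exists_subsuperset_card_eq (Finset.subset_univ A) hA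
    (by simpa using hℓk)
  exact ⟨B, hAB, hB⟩

theorem exists_lineCovers_card_eq {n k ℓ : ℕ} (hℓ : 1 ≤ ℓ) (hℓk : ℓ ≤ k) :
    ∃ (P : Finset (Fin k → Fin n)) (D : (Fin k → Fin n) → Finset (Fin k)),
      (∀ x, (D x).card = ℓ) ∧ LineCovers P D ∧ P.card = rookCoverNumber n k ℓ := by
  classical
  obtain ⟨B, hB0, hB⟩ := exists_finset_fin_card hℓk {⟨0, by omega⟩} (by simpa using hℓ)
  have hne : {N : ℕ | ∃ S : Finset (Rook n k ℓ), IsRookCovering S ∧ S.card = N}.Nonempty := by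
    let e : (Fin k → Fin n) ↪ Rook n k ℓ :=
      ⟨fun x => ⟨x, B, hB⟩, fun x y hxy => congrArg Rook.pos hxy⟩
    refine ⟨_, Finset.univ.map e, ⟨?_, fun x => ⟨e x, Finset.mem_map_of_mem e (Finset.mem_univ x),
      _, hB0 (Finset.mem_singleton_self _), fun _ _ => rfl⟩⟩, rfl⟩
    intro a ha b hb hab
    simp only [Finset.coe_map, Set.mem_image] at ha hb
    obtain ⟨x, -, rfl⟩ := ha
    obtain ⟨y, -, rfl⟩ := hb
    have hxy : x = y := hab
    rw [hxy]
  obtain ⟨S, ⟨hinj, hcov⟩, hcard⟩ := Nat.sInf_mem hne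
  -- Rooks of `S` occupy distinct points, so the directions are a function of the position; `B` is a
  -- filler off `S`.
  refine ⟨S.image Rook.pos,
    fun x => if h : ∃ r ∈ S, r.pos = x then h.choose.dirs else B, ?_, ?_, ?_⟩
  · intro x
    dsimp only
    split_ifs with h
    · exact h.choose.card_dirs
    · exact hB
  · intro x
    obtain ⟨r, hr, i, hi, hx⟩ := hcov x
    refine ⟨r.pos, Finset.mem_image_of_mem _ hr, i, ?_, hx⟩
    have h : ∃ r' ∈ S, r'.pos = r.pos := ⟨r, hr, rfl⟩
    have hch : h.choose = r := hinj h.choose_spec.1 hr h.choose_spec.2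
    simpa only [dif_pos h, hch] using hi
  · rw [Finset.card_image_of_injOn hinj, hcard]
    rfl

/-! ### Blow-ups -/

/-- Blowing up each letter `t` times, with the `j`-th family of directions used on the layer where
the new coordinates sum to `j`. -/
theorem rookCoverNumber_blowup_le {n k ℓ g t : ℕ} {α : Type*} [Fintype α]
    (hα : Fintype.card α = n) (hk : 1 ≤ k) (ht : 1 ≤ t) (hg : g ≤ t) (C : Finset (Fin k → α))
    (D : ℕ → (Fin k → α) → Finset (Fin k)) (hD : ∀ j x, (D j x).card = ℓ)
    (h : ∀ x : Fin k → α, ∃ c ∈ C, ∃ j < g, ∃ i ∈ D j c, ∀ l, l ≠ i → x l = c l) :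
    rookCoverNumber (t * n) k ℓ ≤ g * t ^ (k - 1) * C.card := by
  classical
  obtain ⟨d, rfl⟩ : ∃ d, k = d + 1 := ⟨k - 1, by omega⟩
  have : NeZero t := ⟨by omega⟩
  -- A layer is parametrized by all coordinates but the first, which the prescribed sum `j`
  -- determines.
  let f : Fin g × (Fin d → ZMod t) × C → (Fin (d + 1) → ZMod t × α) :=
    fun y i => ((Fin.cons (((y.1 : ℕ) : ZMod t) - ∑ l, y.2.1 l) y.2.1 : Fin (d + 1) → ZMod t) i,
      y.2.2.1 i)
  have hcard : (Finset.univ.image f).card ≤ g * t ^ (d + 1 - 1) * C.card := by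
    refine Finset.card_image_le.trans (le_of_eq ?_)
    simp [Fintype.card_prod, ZMod.card, mul_assoc]
  refine le_trans (rookCoverNumber_le_card (α := ZMod t × α) (by simp [ZMod.card, hα])
    (Finset.univ.image f) (fun x => D (∑ i, (x i).1).val (fun i => (x i).2))
    (fun x => hD _ _) ?_) hcard
  intro x
  obtain ⟨c, hc, j, hj, i, hi, hx⟩ := h (fun i => (x i).2)
  -- Only coordinate `i`, the one in which the rook may move, is altered to bring the sum to `j`.
  let w : Fin (d + 1) → ZMod t :=
    Function.update (fun l => (x l).1) i ((x i).1 + (j - ∑ l, (x l).1))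
  have hw : ∑ l, w l = j := by
    rw [Finset.sum_update_of_mem (Finset.mem_univ i),
      ← Finset.add_sum_erase Finset.univ (fun l => (x l).1) (Finset.mem_univ i),
      Finset.sdiff_singleton_eq_erase]
    ring
  have hw0 : (Fin.cons ((j : ZMod t) - ∑ l, Fin.tail w l) (Fin.tail w) : Fin (d + 1) → ZMod t)
      = w := by
    rw [← hw, Fin.sum_univ_succ]
    simp [Fin.tail]
  refine ⟨fun l => (w l, c l), ?_, i, ?_, ?_⟩
  · refine Finset.mem_image.2
      ⟨(⟨j, hj⟩, Fin.tail w, ⟨c, hc⟩), Finset.mem_univ _, ?_⟩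
    funext l
    simp only [f]
    rw [hw0]
  · simp only [hw]
    rwa [ZMod.val_cast_of_lt (lt_of_lt_of_le hj hg)]
  · intro l hl
    have := hx l hl
    ext
    · simp [w, hl]
    · exact this

theorem rookCoverNumber_mul_le {k ℓ : ℕ} (hℓ : 1 ≤ ℓ) (hℓk : ℓ ≤ k) (t n : ℕ) (ht : 1 ≤ t) :
    rookCoverNumber (t * n) k ℓ ≤ t ^ (k - 1) * rookCoverNumber n k ℓ := by
  obtain ⟨P, D, hD, h, hP⟩ := exists_lineCovers_card_eq (n := n) hℓ hℓk
  have := rookCoverNumber_blowup_le (g := 1) (t := t) (Fintype.card_fin n) (hℓ.trans hℓk) ht ht P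
    (fun _ => D) (fun _ => hD) (fun x => by
      obtain ⟨c, hc, i, hi, hx⟩ := h x
      exact ⟨c, hc, 0, one_pos, i, hi, hx⟩)
  rwa [one_mul, hP] at this

/-! ### Enlarging the cube -/

theorem card_filter_le_coord_and_coord_eq {M N k : ℕ} (i j : Fin k) (hij : i ≠ j) (a : Fin N) :
    (Finset.univ.filter fun x : Fin k → Fin N => M ≤ (x i : ℕ) ∧ x j = a).card
      ≤ (N - M) * N ^ (k - 2) := by
  classical
  let s : Fin k → Finset (Fin N) := fun l =>
    if l = i then Finset.univ.filter (fun y : Fin N => M ≤ (y : ℕ))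
    else if l = j then {a} else Finset.univ
  have hsub : (Finset.univ.filter fun x : Fin k → Fin N => M ≤ (x i : ℕ) ∧ x j = a)
      ⊆ Fintype.piFinset s := by
    intro x hx
    simp only [Finset.mem_filter, Finset.mem_univ, true_and] at hx
    rw [Fintype.mem_piFinset]
    intro l
    simp only [s]
    split_ifs with h1 h2
    · subst h1; simpa using hx.1
    · subst h2; simpa using hx.2
    · simp
  refine (Finset.card_le_card hsub).trans ?_
  have hi : (s i).card ≤ N - M := by
    have : (s i).card = (Finset.map Fin.valEmbedding (s i)).card := (Finset.card_map _).symm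
    rw [this, ← Nat.card_Ico]
    refine Finset.card_le_card fun y hy => ?_
    obtain ⟨z, hz, rfl⟩ := Finset.mem_map.1 hy
    simp only [s, if_true, Finset.mem_filter, Finset.mem_univ, true_and] at hz
    simpa using hz
  have hj : (s j).card = 1 := by simp [s, hij.symm]
  rw [Fintype.card_piFinset, ← Finset.mul_prod_erase _ _ (Finset.mem_univ i),
    ← Finset.mul_prod_erase _ _ (Finset.mem_erase.2 ⟨hij.symm, Finset.mem_univ j⟩), hj, one_mul]
  refine Nat.mul_le_mul hi (le_of_eq ?_)
  rw [Finset.prod_congr rfl (g := fun _ => N), Finset.prod_const, Finset.card_erase_of_mem,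
    Finset.card_erase_of_mem (Finset.mem_univ i), Finset.card_univ, Fintype.card_fin]
  · congr 1
  · exact Finset.mem_erase.2 ⟨hij.symm, Finset.mem_univ j⟩
  · intro l hl
    simp only [Finset.mem_erase] at hl
    simp [s, hl.1, hl.2.1]

/-- Enlarging the cube from side `M` to side `N` costs one rook per line in each new slab. -/
theorem rookCoverNumber_le_add {k ℓ M N : ℕ} (hk : 2 ≤ k) (hℓ : 1 ≤ ℓ) (hℓk : ℓ ≤ k)
    (hM : 1 ≤ M) (hMN : M ≤ N) :
    rookCoverNumber N k ℓ ≤ rookCoverNumber M k ℓ + k * ((N - M) * N ^ (k - 2)) := by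
  classical
  obtain ⟨d, rfl⟩ : ∃ d, k = d + 2 := ⟨k - 2, by omega⟩
  obtain ⟨P, D, hD, h, hP⟩ := exists_lineCovers_card_eq (n := M) hℓ hℓk
  obtain ⟨B₀, hB₀, hB₀c⟩ := exists_finset_fin_card hℓk {0} (by simpa using hℓ)
  obtain ⟨B₁, hB₁, hB₁c⟩ := exists_finset_fin_card hℓk {1} (by simpa using hℓ)
  replace hB₀ := hB₀ (Finset.mem_singleton_self _)
  replace hB₁ := hB₁ (Finset.mem_singleton_self _)
  let z : Fin N := ⟨0, by omega⟩
  -- The slab where coordinate `i` is at least `M` is covered by lines in direction `o i`, with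
  -- rooks where that coordinate is `0`. As `0 < M`, testing coordinate `0` of a rook tells which
  -- direction it needs.
  let o : Fin (d + 2) → Fin (d + 2) := fun i => if i = 0 then 1 else 0
  have ho : ∀ i, i ≠ o i := by
    intro i
    simp only [o]
    split_ifs with hi
    · rw [hi]; exact Fin.zero_ne_one
    · exact hi
  let E : Fin (d + 2) → Finset (Fin (d + 2) → Fin N) := fun i =>
    Finset.univ.filter fun x => M ≤ (x i : ℕ) ∧ x (o i) = z
  let c : (Fin (d + 2) → Fin M) → (Fin (d + 2) → Fin N) := fun x i => Fin.castLE hMN (x i)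
  let D' : (Fin (d + 2) → Fin N) → Finset (Fin (d + 2)) := fun x =>
    if hx : ∀ i, (x i : ℕ) < M then D (fun i => ⟨x i, hx i⟩)
    else if M ≤ (x 0 : ℕ) then B₁ else B₀
  have hcov : LineCovers (P.image c ∪ Finset.univ.biUnion E) D' := by
    intro y
    by_cases hy : ∀ i, (y i : ℕ) < M
    · obtain ⟨p, hp, i, hi, hx⟩ := h (fun i => ⟨y i, hy i⟩)
      refine ⟨c p, Finset.mem_union_left _ (Finset.mem_image_of_mem _ hp), i, ?_, fun j hj => ?_⟩
      · have hlt : ∀ l, (c p l : ℕ) < M := fun l => (p l).2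
        simp only [D']
        rw [dif_pos hlt]
        exact hi
      · have := congrArg Fin.val (hx j hj)
        exact Fin.ext this
    · push Not at hy
      by_cases h0 : M ≤ (y 0 : ℕ)
      · have hx0 : M ≤ (Function.update y 1 z 0 : ℕ) := by
          rwa [Function.update_of_ne Fin.zero_ne_one]
        refine ⟨Function.update y 1 z, Finset.mem_union_right _ (Finset.mem_biUnion.2
          ⟨0, Finset.mem_univ _, ?_⟩), 1, ?_, fun j hj => by simp [hj]⟩
        · simp only [E, Finset.mem_filter, Finset.mem_univ, true_and]
          exact ⟨hx0, by simp [o]⟩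
        · simp only [D']
          rw [dif_neg (fun hx => absurd (hx 0) (not_lt.2 hx0)), if_pos hx0]
          exact hB₁
      · obtain ⟨i, hi⟩ := hy
        have hi0 : i ≠ 0 := fun hh => h0 (hh ▸ hi)
        have hxi : M ≤ (Function.update y 0 z i : ℕ) := by
          rwa [Function.update_of_ne hi0]
        refine ⟨Function.update y 0 z, Finset.mem_union_right _ (Finset.mem_biUnion.2
          ⟨i, Finset.mem_univ _, ?_⟩), 0, ?_, fun j hj => by simp [hj]⟩
        · simp only [E, Finset.mem_filter, Finset.mem_univ, true_and]
          exact ⟨hxi, by simp [o, hi0]⟩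
        · simp only [D']
          rw [dif_neg (fun hx => absurd (hx i) (not_lt.2 hxi)), if_neg]
          · exact hB₀
          · simp only [Function.update_self, z]
            omega
  refine (rookCoverNumber_le_card_of_fin _ D' ?_ hcov).trans
    ((Finset.card_union_le _ _).trans (Nat.add_le_add ?_ ?_))
  · intro x
    simp only [D']
    split_ifs
    · exact hD _
    · exact hB₁c
    · exact hB₀c
  · rw [← hP]
    exact Finset.card_image_le
  · refine (Finset.card_biUnion_le_card_mul _ _ _ fun i _ =>
      card_filter_le_coord_and_coord_eq i (o i) (ho i) z).trans ?_
    simp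

/-! ### Existence of the limit -/

theorem rookCoverRatio_nonneg (k ℓ n : ℕ) : 0 ≤ rookCoverRatio k ℓ n := by
  unfold rookCoverRatio
  positivity

/-- Blow up to the largest multiple of `n` not exceeding `N`, then add slabs of thickness less than
`n`. -/
theorem rookCoverRatio_le_add {k ℓ n N : ℕ} (hk : 2 ≤ k) (hℓ : 1 ≤ ℓ) (hℓk : ℓ ≤ k)
    (hn : 1 ≤ n) (hN : n ≤ N) :
    rookCoverRatio k ℓ N ≤ rookCoverRatio k ℓ n + (k * n : ℝ) / N := by
  obtain ⟨d, rfl⟩ : ∃ d, k = d + 2 := ⟨k - 2, by omega⟩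
  have ht : 1 ≤ N / n := (Nat.one_le_div_iff (by omega)).2 hN
  have hle : N / n * n ≤ N := Nat.div_mul_le_self N n
  have hdiff : N - N / n * n ≤ n := by
    have := Nat.div_add_mod N n
    have h2 := Nat.mod_lt N (show 0 < n by omega)
    rw [mul_comm] at this
    omega
  have h1 := rookCoverNumber_le_add (M := N / n * n) hk hℓ hℓk (Nat.mul_pos ht hn) hle
  have h2 := rookCoverNumber_mul_le hℓ hℓk (N / n) n ht
  have h3 : rookCoverNumber N (d + 2) ℓ ≤
      (N / n) ^ (d + 1) * rookCoverNumber n (d + 2) ℓ + (d + 2) * (n * N ^ d) :=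
    h1.trans (Nat.add_le_add h2 (by rw [Nat.add_sub_cancel]; gcongr))
  have h4 : (rookCoverNumber N (d + 2) ℓ : ℝ) ≤
      ((N / n : ℕ) : ℝ) ^ (d + 1) * rookCoverNumber n (d + 2) ℓ + (d + 2) * (n * N ^ d) := by
    exact_mod_cast h3
  have hn0 : (0 : ℝ) < n := by exact_mod_cast hn
  have hN0 : (0 : ℝ) < N := by exact_mod_cast hn.trans hN
  have hdiv : ((N / n : ℕ) : ℝ) ≤ (N : ℝ) / n := Nat.cast_div_le
  have h5 : (rookCoverNumber N (d + 2) ℓ : ℝ) ≤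
      ((N : ℝ) / n) ^ (d + 1) * rookCoverNumber n (d + 2) ℓ + (d + 2) * (n * N ^ d) :=
    h4.trans (by gcongr)
  unfold rookCoverRatio
  rw [show d + 2 - 1 = d + 1 from rfl, div_le_iff₀ (by positivity)]
  refine h5.trans (le_of_eq ?_)
  rw [div_pow]
  push_cast
  field_simp
  ring

theorem tendsto_rookCoverRatio_and_le {k ℓ : ℕ} (hk : 2 ≤ k) (hℓ : 1 ≤ ℓ) (hℓk : ℓ ≤ k) :
    Tendsto (rookCoverRatio k ℓ) atTop (𝓝 (rookCoverLimit k ℓ)) ∧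
      ∀ n, 1 ≤ n → rookCoverLimit k ℓ ≤ rookCoverRatio k ℓ n := by
  -- The shift excludes `n = 0`, where division by zero gives the ratio `0`.
  set L : ℝ := ⨅ n : ℕ, rookCoverRatio k ℓ (n + 1) with hL
  have hbdd : BddBelow (Set.range fun n : ℕ => rookCoverRatio k ℓ (n + 1)) :=
    ⟨0, by rintro _ ⟨n, rfl⟩; exact rookCoverRatio_nonneg k ℓ _⟩
  have hinf : ∀ n, 1 ≤ n → L ≤ rookCoverRatio k ℓ n := by
    intro n hn
    obtain ⟨n, rfl⟩ : ∃ n', n = n' + 1 := ⟨n - 1, by omega⟩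
    exact ciInf_le hbdd n
  have htend : Tendsto (rookCoverRatio k ℓ) atTop (𝓝 L) := by
    refine tendsto_order.2 ⟨fun a ha => ?_, fun a ha => ?_⟩
    · filter_upwards [eventually_ge_atTop 1] with n hn
      exact ha.trans_le (hinf n hn)
    · obtain ⟨n, hn⟩ := exists_lt_of_ciInf_lt ha
      have hlim : Tendsto (fun N : ℕ => rookCoverRatio k ℓ (n + 1)
          + (k * (n + 1 : ℕ) : ℝ) / N) atTop (𝓝 (rookCoverRatio k ℓ (n + 1) + 0)) :=
        tendsto_const_nhds.add (tendsto_const_div_atTop_nhds_zero_nat _)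
      rw [add_zero] at hlim
      filter_upwards [hlim.eventually_lt_const hn, eventually_ge_atTop (n + 1)] with N h1 h2
      exact (rookCoverRatio_le_add hk hℓ hℓk (by omega) h2).trans_lt h1
  have hlim : rookCoverLimit k ℓ = L := htend.limUnder_eq
  rw [hlim]
  exact ⟨htend, hinf⟩

/-! ### Covering codes -/

/-- The kernel of a map onto the plane whose columns represent every point of the projective line
is a covering code of radius one. -/
theorem exists_covering_code_of_field (F : Type) [Field F] [Fintype F] {k : ℕ}
    (hk : Fintype.card F + 1 ≤ k) :
    ∃ C : Finset (Fin k → F), C.card = Fintype.card F ^ (k - 2) ∧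
      ∀ x : Fin k → F, ∃ c ∈ C, ∃ i : Fin k, (i : ℕ) < Fintype.card F + 1 ∧ ∀ j, j ≠ i → x j = c j := by
  classical
  obtain ⟨N, rfl⟩ : ∃ N, k = N + 1 := ⟨k - 1, by omega⟩
  let e : Fin (Fintype.card F) ≃ F := (Fintype.equivFin F).symm
  -- The columns `(1, a)` and `(0, 1)` represent the projective line; the others vanish and are
  -- never used to correct a syndrome.
  let col : Fin (N + 1) → F × F := fun i =>
    if h : (i : ℕ) < Fintype.card F then (1, e ⟨i, h⟩)
    else if (i : ℕ) = Fintype.card F then (0, 1) else 0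
  let H : (Fin (N + 1) → F) →ₗ[F] F × F := Fintype.linearCombination F col
  have hsyn : ∀ s : F × F, ∃ (a : F) (i : Fin (N + 1)), (i : ℕ) < Fintype.card F + 1 ∧
      H (Pi.single i a) = s := by
    rintro ⟨s₁, s₂⟩
    by_cases hs : s₁ = 0
    · refine ⟨s₂, ⟨Fintype.card F, by omega⟩, by simp, ?_⟩
      simp [H, Fintype.linearCombination_apply_single, col, hs]
    · have hlt : ((e.symm (s₂ / s₁) : Fin _) : ℕ) < Fintype.card F := (e.symm (s₂ / s₁)).2
      refine ⟨s₁, ⟨(e.symm (s₂ / s₁) : Fin _), by omega⟩, by simp only; omega, ?_⟩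
      simp [H, Fintype.linearCombination_apply_single, col]
      field_simp
  have hsurj : Function.Surjective H := fun s => by
    obtain ⟨a, i, -, h⟩ := hsyn s
    exact ⟨_, h⟩
  refine ⟨Finset.univ.filter (fun x => H x = 0), ?_, fun x => ?_⟩
  · have hrank := LinearMap.finrank_range_add_finrank_ker H
    rw [LinearMap.range_eq_top.2 hsurj, finrank_top, Module.finrank_prod, Module.finrank_self,
      Module.finrank_fin_fun] at hrank
    have hker : Module.finrank F (LinearMap.ker H) = N + 1 - 2 := by omega
    have hc := Module.card_eq_pow_finrank (K := F) (V := LinearMap.ker H)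
    rw [hker] at hc
    rw [← hc, ← Fintype.card_subtype]
    exact Fintype.card_congr (Equiv.refl _)
  · obtain ⟨a, i, hi, h⟩ := hsyn (H x)
    refine ⟨x - Pi.single i a, by simp [h], i, hi, fun j hj => by simp [hj]⟩

theorem exists_covering_code {p e k : ℕ} (hp : p.Prime) (hk : p ^ e + 1 ≤ k) :
    ∃ (α : Type) (_ : Fintype α) (C : Finset (Fin k → α)), Fintype.card α = p ^ e ∧
      C.card = (p ^ e) ^ (k - 2) ∧
      ∀ x : Fin k → α, ∃ c ∈ C, ∃ i : Fin k, (i : ℕ) < p ^ e + 1 ∧ ∀ j, j ≠ i → x j = c j := by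
  classical
  rcases Nat.eq_zero_or_pos e with rfl | he
  · refine ⟨Unit, inferInstance, Finset.univ, by simp, by simp, fun x => ⟨x, Finset.mem_univ _,
      ⟨0, by omega⟩, by simp, fun _ _ => rfl⟩⟩
  · have := Fact.mk hp
    let _ : Fintype (GaloisField p e) := Fintype.ofFinite _
    have hcard : Fintype.card (GaloisField p e) = p ^ e := by
      rw [← Nat.card_eq_fintype_card]
      exact GaloisField.card p e he.ne'
    obtain ⟨C, h1, h2⟩ := exists_covering_code_of_field (GaloisField p e) (k := k)
      (by rwa [hcard])
    rw [hcard] at h1 h2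
    exact ⟨GaloisField p e, inferInstance, C, hcard, h1, h2⟩

/-! ### The bound from grouped directions -/

theorem exists_rookCoverRatio_le {k ℓ p e : ℕ} (hℓ : 1 ≤ ℓ) (hℓk : ℓ ≤ k) (hp : p.Prime)
    (hk : p ^ e + 1 ≤ k) :
    ∃ n, 1 ≤ n ∧ rookCoverRatio k ℓ n ≤
      1 / (p ^ e : ℕ) * (⌈((p ^ e + 1 : ℕ) : ℝ) / ℓ⌉ : ℝ) := by
  classical
  have hq : 1 ≤ p ^ e := Nat.pow_pos hp.pos
  obtain ⟨α, _, C, hα, hC, hcov⟩ := exists_covering_code hp hk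
  generalize p ^ e = q at *
  obtain ⟨d, rfl⟩ : ∃ d, k = d + 2 := ⟨k - 2, by omega⟩
  set g : ℕ := ⌈((q + 1 : ℕ) : ℝ) / ℓ⌉₊ with hg
  have hℓ0 : (0 : ℝ) < ℓ := by exact_mod_cast hℓ
  have hg1 : 1 ≤ g := Nat.ceil_pos.2 (by positivity)
  have hgℓ : q + 1 ≤ g * ℓ := by
    have := (div_le_iff₀ hℓ0).1 (Nat.le_ceil (((q + 1 : ℕ) : ℝ) / ℓ))
    exact_mod_cast this
  -- Group `j` consists of the directions from `j * ℓ` to `j * ℓ + ℓ - 1`, padded to size `ℓ` if it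
  -- is short.
  have hgroup : ∀ j : ℕ, ∃ B : Finset (Fin (d + 2)),
      (Finset.univ.filter fun i : Fin (d + 2) => (i : ℕ) / ℓ = j) ⊆ B ∧ B.card = ℓ := by
    intro j
    refine exists_finset_fin_card hℓk _ ?_
    rw [← Finset.card_map Fin.valEmbedding]
    refine (Finset.card_le_card (t := Finset.Ico (j * ℓ) (j * ℓ + ℓ)) fun y hy => ?_).trans
      (by simp)
    obtain ⟨i, hi, rfl⟩ := Finset.mem_map.1 hy
    simp only [Finset.mem_filter, Finset.mem_univ, true_and] at hi
    have h1 := (Nat.div_eq_iff (by omega)).1 hi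
    simp only [Fin.valEmbedding_apply, Finset.mem_Ico]
    omega
  choose B hBsub hBcard using hgroup
  have hle := rookCoverNumber_blowup_le hα (by omega) hg1 le_rfl C (fun j _ => B j)
    (fun j _ => hBcard j) (fun x => by
      obtain ⟨c, hc, i, hi, hx⟩ := hcov x
      exact ⟨c, hc, (i : ℕ) / ℓ, Nat.div_lt_of_lt_mul (by rw [mul_comm]; omega), i,
        hBsub _ (by simp), hx⟩)
  rw [hC] at hle
  refine ⟨g * q, Nat.mul_pos hg1 hq, ?_⟩
  have hceil : (⌈((q + 1 : ℕ) : ℝ) / ℓ⌉ : ℝ) = g := by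
    rw [hg, natCast_ceil_eq_intCast_ceil (by positivity)]
  have hg0 : (0 : ℝ) < g := by exact_mod_cast hg1
  have hq0 : (0 : ℝ) < q := by exact_mod_cast hq
  have hle' : (rookCoverNumber (g * q) (d + 2) ℓ : ℝ) ≤ g * (g : ℝ) ^ (d + 1) * (q : ℝ) ^ d := by
    exact_mod_cast hle
  rw [hceil]
  unfold rookCoverRatio
  rw [show d + 2 - 1 = d + 1 from rfl, div_le_iff₀ (by push_cast; positivity)]
  refine hle'.trans (le_of_eq ?_)
  push_cast
  field_simp
  ring

theorem mainTheorem6 (k ℓ : ℕ) (hk : 2 ≤ k) (hℓ : 1 ≤ ℓ) (hf : ℓ ≤ largestPrimePowerSucc k) :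
    Tendsto (rookCoverRatio k ℓ) atTop (𝓝 (rookCoverLimit k ℓ)) ∧
    rookCoverLimit k ℓ ≤
      1 / ((largestPrimePowerSucc k : ℝ) - 1) * (⌈(largestPrimePowerSucc k : ℝ) / (ℓ : ℝ)⌉ : ℝ) ∧
    ∀ m : ℕ, IsPrimePowerSucc m → ℓ ≤ m → m ≤ k →
      rookCoverLimit k ℓ ≤ 1 / ((m : ℝ) - 1) * (⌈(m : ℝ) / (ℓ : ℝ)⌉ : ℝ) := by
  classical
  have hfk : largestPrimePowerSucc k ≤ k := Nat.findGreatest_le k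
  have hfspec : IsPrimePowerSucc (largestPrimePowerSucc k) := by
    unfold largestPrimePowerSucc
    exact Nat.findGreatest_spec (P := IsPrimePowerSucc) hk ⟨2, 0, Nat.prime_two, rfl⟩
  have hℓk := hf.trans hfk
  obtain ⟨htend, hle⟩ := tendsto_rookCoverRatio_and_le hk hℓ hℓk
  have hmain : ∀ m : ℕ, IsPrimePowerSucc m → ℓ ≤ m → m ≤ k →
      rookCoverLimit k ℓ ≤ 1 / ((m : ℝ) - 1) * (⌈(m : ℝ) / (ℓ : ℝ)⌉ : ℝ) := by
    rintro m ⟨p, e, hp, rfl⟩ - hmk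
    obtain ⟨n, hn, h⟩ := exists_rookCoverRatio_le hℓ hℓk hp hmk
    refine (hle n hn).trans (h.trans (le_of_eq ?_))
    push_cast
    rw [add_sub_cancel_right]
  exact ⟨htend, hmain _ hfspec hf hfk, hmain⟩
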